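/- Let $p,q\ge 1$ and $m\ge -2$ be integers, and for $|x|<1$ and $p \ge 1$ let $\mathrm{Li}_p(x)=\sum_{k=1}^{\infty}\frac{x^k}{k^p}$. Then the integral \[ J(m,p,q)=\int_0^1 x^m\,\mathrm{Li}_p(x)\,\mathrm{Li}_q(x)\,dx \] converges (the integrand is Lebesgue integrable on $(0,1)$), and $J(m,p,q)$ is reducible to a rational constant and zeta values at positive integers: it equals a rational constant plus a finite linear combination, with rational coefficients, of products $\zeta(n_1)\cdots\zeta(n_r)$, where $r\ge 1$ and all $n_i\ge 2$ are integers. -/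

import Mathlib

/-- The polylogarithm `Li_p(x) = ∑_{k ≥ 1} x ^ k / k ^ p`; the series converges for `|x| < 1`. -/
noncomputable def polylog (p : ℕ) (x : ℝ) : ℝ :=
  ∑' k : ℕ, x ^ (k + 1) / ((k : ℝ) + 1) ^ p

/-- The integrand `x ^ m Li_p(x) Li_q(x)`, where `m` may be negative. -/
noncomputable def polylogIntegrand (m : ℤ) (p q : ℕ) (x : ℝ) : ℝ :=
  x ^ m * polylog p x * polylog q x

/-- `J(m, p, q) = ∫₀¹ x ^ m Li_p(x) Li_q(x) dx`. -/
noncomputable def polylogIntegral (m : ℤ) (p q : ℕ) : ℝ :=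
  ∫ x in (0 : ℝ)..1, polylogIntegrand m p q x

/-- The products `ζ(n₁) ⋯ ζ(n_r)` with `r ≥ 1` and all `n_i` integers at least `2`.
The value `n_i = 1`, where `ζ` has its pole, is excluded. -/
def zetaProducts : Set ℂ :=
  {z | ∃ t : Multiset ℕ, t ≠ 0 ∧ (∀ n ∈ t, 2 ≤ n) ∧
    z = (t.map fun n : ℕ => riemannZeta (n : ℂ)).prod}

/-- `x` is a rational constant plus a (finite) rational linear combination of products of
zeta values at positive integers. -/
def IsReducibleToZetaValues (x : ℝ) : Prop :=
  ∃ c : ℚ, ∃ y ∈ Submodule.span ℚ zetaProducts, (x : ℂ) = (c : ℂ) + y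

/-!
The integral is turned into a double series: for `0 < x < 1` the integrand is a double power series
with positive terms, and integrating term by term with `n = m + 2` gives
`J(m, p, q) = T n p q := ∑ 1 / (a ^ p b ^ q (a + b + n - 1))`, the sum running over `a, b ≥ 1`
(`integralTerm` is the general term, with `a` and `b` shifted to start at `0`). The series converges
because `a + b + n - 1 ≥ √(a b)`. Convergence of the integral follows, and what remains is to reduce
the sums `T n p q` by partial fractions.

For `n = 1`, multiplying by `1 = (a + b) / (a + b)` gives
`ζ(p + 1) ζ(q + 1) = T 1 p (q + 1) + T 1 (p + 1) q`, so every `T 1 p q` reduces to some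
`T 1 r 1 = ∑ H_k / k ^ (r + 1)`. This is Euler's sum (`tsum_integralTerm_one_eq_realZeta`): it is
`ζ(r + 1, 1) + ζ(r + 2)` in terms of double zeta values, the sum formula `sum_doubleZeta` expresses
it through the `ζ(k, l)` with `k, l ≥ 2` and `k + l = r + 2`, and the stuffle product
`realZeta_mul_realZeta` evaluates the sum of these.

For `n ≠ 1`, write `D n p q = T 1 p q - T n p q`. Subtracting the same partial fraction identity for
`n` and for `1` gives `(n - 1) T n p q = D n (p - 1) q + D n p (q - 1)`, which lowers `p + q`. The
recursion stops at `D n 0 q`, a convergent difference of divergent series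
(`reducibleSum_integralTerm_sub_zero`): the sum over `a` telescopes, leaving
sums `∑ 1 / (b ^ q (b + j))`, which are rational combinations of `1` and zeta values.
-/

open MeasureTheory Filter Topology Finset

namespace PolylogIntegral

theorem hasSum_of_forall_eq {ι : Type*} {f g : ι → ℝ} {v : ℝ} (hf : HasSum f v)
    (hfg : ∀ i, g i = f i) : HasSum g v :=
  (funext hfg : g = f) ▸ hf

/-! ### Reducible numbers and reducible sums -/

theorem isReducible_ratCast (r : ℚ) : IsReducibleToZetaValues (r : ℝ) :=
  ⟨r, 0, Submodule.zero_mem _, by simp⟩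

theorem _root_.IsReducibleToZetaValues.add {x y : ℝ} (hx : IsReducibleToZetaValues x)
    (hy : IsReducibleToZetaValues y) : IsReducibleToZetaValues (x + y) := by
  obtain ⟨c, u, hu, hx⟩ := hx
  obtain ⟨d, v, hv, hy⟩ := hy
  refine ⟨c + d, u + v, Submodule.add_mem _ hu hv, ?_⟩
  push_cast
  rw [hx, hy]
  ring

theorem _root_.IsReducibleToZetaValues.ratCast_mul {x : ℝ} (r : ℚ)
    (hx : IsReducibleToZetaValues x) : IsReducibleToZetaValues ((r : ℝ) * x) := by
  obtain ⟨c, u, hu, hx⟩ := hx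
  refine ⟨r * c, r • u, Submodule.smul_mem _ _ hu, ?_⟩
  push_cast
  rw [hx, Rat.smul_def]
  ring

theorem _root_.IsReducibleToZetaValues.finset_sum {ι : Type*} (s : Finset ι) (f : ι → ℝ)
    (hf : ∀ i ∈ s, IsReducibleToZetaValues (f i)) :
    IsReducibleToZetaValues (∑ i ∈ s, f i) := by
  classical
  induction s using Finset.induction_on with
  | empty => simpa using isReducible_ratCast 0
  | insert a s ha ih =>
    rw [Finset.sum_insert ha]
    exact IsReducibleToZetaValues.add (hf _ (by simp)) (ih fun i hi => hf i (by simp [hi]))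

/-- `f` is summable, with a sum that is reducible to zeta values. -/
def ReducibleSum {ι : Type*} (f : ι → ℝ) : Prop :=
  ∃ v, HasSum f v ∧ IsReducibleToZetaValues v

theorem ReducibleSum.add {ι : Type*} {f g : ι → ℝ} (hf : ReducibleSum f) (hg : ReducibleSum g) :
    ReducibleSum fun i => f i + g i := by
  obtain ⟨u, hu, hu'⟩ := hf
  obtain ⟨v, hv, hv'⟩ := hg
  exact ⟨_, hu.add hv, IsReducibleToZetaValues.add hu' hv'⟩

theorem ReducibleSum.ratCast_mul {ι : Type*} {f : ι → ℝ} (r : ℚ) (hf : ReducibleSum f) :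
    ReducibleSum fun i => (r : ℝ) * f i := by
  obtain ⟨u, hu, hu'⟩ := hf
  exact ⟨_, hu.mul_left _, IsReducibleToZetaValues.ratCast_mul r hu'⟩

theorem ReducibleSum.sub {ι : Type*} {f g : ι → ℝ} (hf : ReducibleSum f) (hg : ReducibleSum g) :
    ReducibleSum fun i => f i - g i := by
  convert hf.add (hg.ratCast_mul (-1)) using 2
  push_cast
  ring

theorem ReducibleSum.comp_swap {f : ℕ × ℕ → ℝ} (hf : ReducibleSum f) :
    ReducibleSum fun i : ℕ × ℕ => f i.swap := by
  obtain ⟨u, hu, hu'⟩ := hf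
  exact ⟨u, (Equiv.prodComm ℕ ℕ).hasSum_iff.mpr hu, hu'⟩

/-! ### Zeta values as real series -/

/-- The real number `ζ(n) = ∑ 1 / (k + 1) ^ n`, for `2 ≤ n`. -/
noncomputable def realZeta (n : ℕ) : ℝ := ∑' k : ℕ, 1 / ((k : ℝ) + 1) ^ n

theorem hasSum_realZeta {n : ℕ} (hn : 2 ≤ n) :
    HasSum (fun k : ℕ => 1 / ((k : ℝ) + 1) ^ n) (realZeta n) := by
  refine Summable.hasSum ?_
  have h := (summable_nat_add_iff 1).mpr (Real.summable_one_div_nat_pow.mpr (show 1 < n by omega))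
  simpa using h

theorem ofReal_realZeta {n : ℕ} (hn : 2 ≤ n) : (realZeta n : ℂ) = riemannZeta n := by
  rw [zeta_eq_tsum_one_div_nat_add_one_cpow (by simpa using (show 1 < n by omega)), realZeta,
    Complex.ofReal_tsum]
  simp

theorem isReducible_realZeta {n : ℕ} (hn : 2 ≤ n) : IsReducibleToZetaValues (realZeta n) :=
  ⟨0, riemannZeta n, Submodule.subset_span ⟨{n}, by simp, by simpa using hn, by simp⟩,
    by simp [ofReal_realZeta hn]⟩

theorem isReducible_realZeta_mul {k l : ℕ} (hk : 2 ≤ k) (hl : 2 ≤ l) :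
    IsReducibleToZetaValues (realZeta k * realZeta l) :=
  ⟨0, riemannZeta k * riemannZeta l,
    Submodule.subset_span ⟨{k, l}, by simp, by simp [hk, hl], by simp⟩,
    by simp [ofReal_realZeta hk, ofReal_realZeta hl]⟩

theorem hasSum_realZeta_mul {k l : ℕ} (hk : 2 ≤ k) (hl : 2 ≤ l) :
    HasSum (fun i : ℕ × ℕ => 1 / (((i.1 : ℝ) + 1) ^ k * ((i.2 : ℝ) + 1) ^ l))
      (realZeta k * realZeta l) := by
  have hk' := hasSum_realZeta hk
  have hl' := hasSum_realZeta hl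
  have h := hk'.mul hl' (hk'.summable.mul_of_nonneg hl'.summable
    (fun _ => by positivity) (fun _ => by positivity))
  exact hasSum_of_forall_eq h fun i => (one_div_mul_one_div _ _).symm

/-! ### Single sums -/

theorem hasSum_telescope (j : ℕ) :
    HasSum (fun b : ℕ => 1 / ((b : ℝ) + j + 1) - 1 / ((b : ℝ) + j + 2)) (1 / ((j : ℝ) + 1)) := by
  rw [hasSum_iff_tendsto_nat_of_nonneg]
  · have h : ∀ n : ℕ, ∑ b ∈ range n, (1 / ((b : ℝ) + j + 1) - 1 / ((b : ℝ) + j + 2))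
        = 1 / ((j : ℝ) + 1) - 1 / ((n : ℝ) + (j + 1)) := by
      intro n
      induction n with
      | zero => simp
      | succ n ih =>
        rw [sum_range_succ, ih]
        push_cast
        rw [show (n : ℝ) + 1 + (j + 1) = n + j + 2 by ring, ← add_assoc (n : ℝ)]
        ring
    simp_rw [h]
    have := (tendsto_const_nhds (x := (1 : ℝ))).div_atTop
      (tendsto_atTop_add_const_right atTop ((j : ℝ) + 1) tendsto_natCast_atTop_atTop)
    simpa using tendsto_const_nhds.sub this
  · intro b
    rw [sub_nonneg]
    gcongr
    norm_num

theorem hasSum_one_div_sub_one_div_add (j : ℕ) :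
    HasSum (fun b : ℕ => 1 / ((b : ℝ) + 1) - 1 / ((b : ℝ) + j + 1))
      (∑ i ∈ range j, 1 / ((i : ℝ) + 1)) := by
  induction j with
  | zero => simp
  | succ j ih =>
    rw [sum_range_succ]
    convert ih.add (hasSum_telescope j) using 2
    push_cast
    ring

theorem reducibleSum_one_div_pow_mul_add (q j : ℕ) :
    ReducibleSum fun b : ℕ => 1 / (((b : ℝ) + 1) ^ (q + 1) * ((b : ℝ) + j + 1)) := by
  rcases Nat.eq_zero_or_pos j with rfl | hj
  · refine ⟨_, ?_, isReducible_realZeta (n := q + 2) (by omega)⟩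
    convert hasSum_realZeta (n := q + 2) (by omega) using 3
    push_cast
    ring
  have hj' : (j : ℝ) ≠ 0 := by positivity
  induction q with
  | zero =>
    have h : ReducibleSum fun b : ℕ => 1 / ((b : ℝ) + 1) - 1 / ((b : ℝ) + j + 1) := by
      refine ⟨_, hasSum_one_div_sub_one_div_add j, ?_⟩
      convert isReducible_ratCast (∑ i ∈ range j, 1 / ((i : ℚ) + 1))
      push_cast
      rfl
    convert h.ratCast_mul (1 / j) using 2 with b
    have : (b : ℝ) + j + 1 ≠ 0 := by positivity
    push_cast
    field_simp
    ring
  | succ q ih =>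
    have h : ReducibleSum fun b : ℕ => 1 / ((b : ℝ) + 1) ^ (q + 2) :=
      ⟨_, hasSum_realZeta (by omega), isReducible_realZeta (by omega)⟩
    convert (h.sub ih).ratCast_mul (1 / j) using 2 with b
    have : (b : ℝ) + j + 1 ≠ 0 := by positivity
    push_cast
    field_simp
    ring

/-! ### Summability of double sums -/

theorem summable_one_div_mul_mul_add :
    Summable fun i : ℕ × ℕ =>
      1 / (((i.1 : ℝ) + 1) * ((i.2 : ℝ) + 1) * ((i.1 : ℝ) + i.2 + 1)) := by
  have h : Summable fun a : ℕ => 1 / ((a : ℝ) + 1) ^ (3 / 2 : ℝ) := by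
    have := (summable_nat_add_iff 1).mpr
      (Real.summable_one_div_nat_rpow.mpr (show (1 : ℝ) < 3 / 2 by norm_num))
    simpa using this
  refine (h.mul_of_nonneg h (fun _ => by positivity) (fun _ => by positivity)).of_nonneg_of_le
    (fun _ => by positivity) fun ⟨a, b⟩ => ?_
  dsimp only
  have hpow : ∀ x : ℝ, 0 < x → x ^ (3 / 2 : ℝ) = x * √x := fun x hx => by
    rw [show (3 / 2 : ℝ) = 1 + 1 / 2 by norm_num, Real.rpow_add hx, Real.rpow_one,
      Real.sqrt_eq_rpow]
  have hsqrt : √((a : ℝ) + 1) * √((b : ℝ) + 1) ≤ a + b + 1 := by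
    rw [← Real.sqrt_mul (by positivity)]
    refine Real.sqrt_le_iff.mpr ⟨by positivity, ?_⟩
    have ha : (0 : ℝ) ≤ a := by positivity
    have hb : (0 : ℝ) ≤ b := by positivity
    nlinarith [mul_nonneg ha hb]
  rw [one_div_mul_one_div, hpow _ (by positivity), hpow _ (by positivity),
    show ((a : ℝ) + 1) * √((a : ℝ) + 1) * (((b : ℝ) + 1) * √((b : ℝ) + 1))
      = ((a : ℝ) + 1) * ((b : ℝ) + 1) * (√((a : ℝ) + 1) * √((b : ℝ) + 1)) by ring]
  gcongr

/-- The double series that do not factor as a product are all compared with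
`∑ 1 / ((a + 1) (b + 1) (a + b + 1))`. -/
theorem summable_one_div_of_le (f : ℕ × ℕ → ℝ)
    (hf : ∀ a b : ℕ, ((a : ℝ) + 1) * ((b : ℝ) + 1) * ((a : ℝ) + b + 1) ≤ f (a, b)) :
    Summable fun i => 1 / f i := by
  have hpos : ∀ a b : ℕ, 0 < ((a : ℝ) + 1) * ((b : ℝ) + 1) * ((a : ℝ) + b + 1) :=
    fun a b => by positivity
  exact summable_one_div_mul_mul_add.of_nonneg_of_le
    (fun ⟨a, b⟩ => (one_div_pos.mpr ((hpos a b).trans_le (hf a b))).le)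
    fun ⟨a, b⟩ => one_div_le_one_div_of_le (hpos a b) (hf a b)

/-- The general term of the double series for `J(n - 2, p, q)`, with indices starting at `0`. -/
noncomputable def integralTerm (n p q : ℕ) (i : ℕ × ℕ) : ℝ :=
  1 / (((i.1 : ℝ) + 1) ^ p * ((i.2 : ℝ) + 1) ^ q * ((i.1 : ℝ) + i.2 + n + 1))

theorem le_self_pow_natCast_add_one (a : ℕ) {p : ℕ} (hp : 1 ≤ p) :
    (a : ℝ) + 1 ≤ ((a : ℝ) + 1) ^ p :=
  le_self_pow₀ (by simp) (by omega)

theorem summable_integralTerm (n : ℕ) {p q : ℕ} (hp : 1 ≤ p) (hq : 1 ≤ q) :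
    Summable (integralTerm n p q) := by
  refine summable_one_div_of_le _ fun a b => ?_
  have h1 := le_self_pow_natCast_add_one a hp
  have h2 := le_self_pow_natCast_add_one b hq
  have h3 : (a : ℝ) + b + 1 ≤ a + b + n + 1 := by linarith [n.cast_nonneg (α := ℝ)]
  dsimp only
  exact mul_le_mul (mul_le_mul h1 h2 (by positivity) (by positivity)) h3
    (by positivity) (by positivity)

/-! ### Double zeta values and Euler's evaluation -/

/-- The general term of the double zeta value `ζ(s, t) = ∑_{m > k} 1 / (m ^ s k ^ t)`, indexed by
`(k - 1, m - k - 1)`. -/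
noncomputable def doubleZetaTerm (s t : ℕ) (i : ℕ × ℕ) : ℝ :=
  1 / (((i.1 : ℝ) + i.2 + 2) ^ s * ((i.1 : ℝ) + 1) ^ t)

/-- The double zeta value `ζ(s, t)`, for `2 ≤ s` and `1 ≤ t`. -/
noncomputable def doubleZeta (s t : ℕ) : ℝ := ∑' i, doubleZetaTerm s t i

theorem hasSum_doubleZeta {s t : ℕ} (hs : 2 ≤ s) (ht : 1 ≤ t) :
    HasSum (doubleZetaTerm s t) (doubleZeta s t) := by
  refine Summable.hasSum (summable_one_div_of_le _ fun a b => ?_)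
  have h1 : ((a : ℝ) + b + 2) ^ 2 ≤ ((a : ℝ) + b + 2) ^ s :=
    pow_le_pow_right₀ (by have : (0 : ℝ) ≤ a + b := by positivity
                          linarith) hs
  have h2 : ((b : ℝ) + 1) * (a + b + 1) ≤ ((a : ℝ) + b + 2) ^ 2 := by
    rw [sq]
    gcongr <;> linarith [a.cast_nonneg (α := ℝ)]
  calc ((a : ℝ) + 1) * (b + 1) * (a + b + 1) = ((b : ℝ) + 1) * (a + b + 1) * (a + 1) := by ring
    _ ≤ _ := by
      gcongr
      · exact h2.trans h1
      · exact le_self_pow_natCast_add_one a ht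

/-- A sum over pairs splits into the sums below, above and on the diagonal. -/
theorem hasSum_of_diagonal_split {f : ℕ × ℕ → ℝ} {u v w : ℝ}
    (hu : HasSum (fun i : ℕ × ℕ => f (i.1 + i.2 + 1, i.1)) u)
    (hv : HasSum (fun i : ℕ × ℕ => f (i.1, i.1 + i.2 + 1)) v)
    (hw : HasSum (fun a : ℕ => f (a, a)) w) : HasSum f (u + (v + w)) := by
  let e : (ℕ × ℕ) ⊕ ((ℕ × ℕ) ⊕ ℕ) → ℕ × ℕ :=
    Sum.elim (fun i => (i.1 + i.2 + 1, i.1))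
      (Sum.elim (fun i => (i.1, i.1 + i.2 + 1)) fun a => (a, a))
  have he : Function.Bijective e := by
    constructor
    · rintro (⟨a, b⟩ | ⟨a, b⟩ | a) (⟨c, d⟩ | ⟨c, d⟩ | c) h <;>
        simp [e] at h ⊢ <;> omega
    · rintro ⟨a, b⟩
      rcases lt_trichotomy a b with h | rfl | h
      · exact ⟨.inr (.inl (a, b - a - 1)), by simp [e]; omega⟩
      · exact ⟨.inr (.inr a), rfl⟩
      · exact ⟨.inl (b, a - b - 1), by simp [e]; omega⟩
  rw [← (Equiv.ofBijective e he).hasSum_iff]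
  exact HasSum.sum hu (HasSum.sum hv hw)

/-- The stuffle product of two zeta values. -/
theorem realZeta_mul_realZeta {k l : ℕ} (hk : 2 ≤ k) (hl : 2 ≤ l) :
    realZeta k * realZeta l = doubleZeta k l + (doubleZeta l k + realZeta (k + l)) := by
  refine (hasSum_realZeta_mul hk hl).unique (hasSum_of_diagonal_split ?_ ?_ ?_)
  · convert hasSum_doubleZeta hk (show 1 ≤ l by omega) using 2 with i
    simp only [doubleZetaTerm]
    push_cast
    ring
  · convert hasSum_doubleZeta hl (show 1 ≤ k by omega) using 2 with i
    simp only [doubleZetaTerm]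
    push_cast
    ring
  · convert hasSum_realZeta (show 2 ≤ k + l by omega) using 3
    rw [pow_add]

/-- Both sides are sums of harmonic numbers: the inner sum over `b` on the left telescopes, and on
the right the terms with `a + b` fixed are collected. -/
theorem tsum_integralTerm_one_eq_doubleZeta (r : ℕ) :
    ∑' i, integralTerm 1 (r + 1) 1 i = doubleZeta (r + 2) 1 + realZeta (r + 3) := by
  have hg : HasSum (fun a : ℕ => (1 / ((a : ℝ) + 1) ^ (r + 2)) *
      ∑ i ∈ range (a + 1), 1 / ((i : ℝ) + 1)) (∑' i, integralTerm 1 (r + 1) 1 i) := by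
    refine (summable_integralTerm 1 (by omega) le_rfl).hasSum.prod_fiberwise fun a => ?_
    refine hasSum_of_forall_eq ((hasSum_one_div_sub_one_div_add (a + 1)).mul_left
      (1 / ((a : ℝ) + 1) ^ (r + 2))) fun b => ?_
    simp only [integralTerm]
    have : (a : ℝ) + b + 1 + 1 ≠ 0 := by positivity
    have : (b : ℝ) + (a + 1) + 1 ≠ 0 := by positivity
    push_cast
    field_simp
    ring
  have hh : HasSum (fun n : ℕ => (1 / ((n : ℝ) + 2) ^ (r + 2)) *
      ∑ i ∈ range (n + 1), 1 / ((i : ℝ) + 1)) (doubleZeta (r + 2) 1) := by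
    have h := HasAntidiagonal.sigmaAntidiagonalEquivProd.hasSum_iff.mpr
      (hasSum_doubleZeta (show 2 ≤ r + 2 by omega) le_rfl)
    refine h.sigma fun n => ?_
    convert hasSum_fintype _
    change _ = ∑ i : antidiagonal n, doubleZetaTerm (r + 2) 1 i
    rw [Finset.sum_coe_sort (antidiagonal n) (fun i => doubleZetaTerm (r + 2) 1 i),
      Finset.Nat.sum_antidiagonal_eq_sum_range_succ_mk, mul_sum]
    refine Finset.sum_congr rfl fun i hi => ?_
    have hi' : i ≤ n := by simpa [Nat.lt_succ_iff] using hi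
    simp only [doubleZetaTerm]
    rw [Nat.cast_sub hi', one_div_mul_one_div, add_sub_cancel, pow_one]
  have hz := (hasSum_nat_add_iff' 1).mpr (hasSum_realZeta (show 2 ≤ r + 3 by omega))
  have hg' := (hasSum_nat_add_iff' 1).mpr hg
  have key := hg'.unique <| hasSum_of_forall_eq (hh.add hz) fun n => by
    rw [sum_range_succ _ (n + 1)]
    push_cast
    rw [show (n : ℝ) + 1 + 1 = n + 2 by ring]
    have : (n : ℝ) + 2 ≠ 0 := by positivity
    field_simp
    ring
  simp at key
  linarith

/-- The partial fraction identity behind the sum formula for double zeta values, with `c = a + b`: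
a finite geometric sum in `a / c`. -/
theorem sum_one_div_pow_mul_pow {a b : ℝ} (ha : 0 < a) (hb : 0 < b) (r : ℕ) :
    ∑ k ∈ range r, 1 / ((a + b) ^ (r + 1 - k) * a ^ (k + 2)) =
      1 / (a ^ (r + 1) * b * (a + b)) - 1 / (a * b * (a + b) ^ (r + 1)) := by
  have hab : a + b ≠ 0 := by positivity
  induction r with
  | zero => simp
  | succ r ih =>
    have h : ∀ k ∈ range r, 1 / ((a + b) ^ (r + 1 + 1 - k) * a ^ (k + 2)) =
        1 / (a + b) * (1 / ((a + b) ^ (r + 1 - k) * a ^ (k + 2))) := fun k hk => by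
      have : k < r := by simpa using hk
      rw [show r + 1 + 1 - k = (r + 1 - k) + 1 by omega, pow_succ]
      field_simp
    rw [sum_range_succ, sum_congr rfl h, ← mul_sum, ih,
      show r + 1 + 1 - r = 2 by omega]
    field_simp
    ring

/-- The sum formula for double zeta values, `∑ ζ(k, l) = ζ(r + 3)` over `k + l = r + 3` with `2 ≤ k`
and `1 ≤ l`, with the term `l = 1` moved to the right and written as a Tornheim sum. -/
theorem sum_doubleZeta (r : ℕ) :
    ∑ k ∈ range r, doubleZeta (r + 1 - k) (k + 2) =
      2 * realZeta (r + 3) - ∑' i, integralTerm 1 (r + 1) 1 i := by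
  have hW := (summable_integralTerm 1 (show 1 ≤ r + 1 by omega) le_rfl).hasSum
  have hD := hasSum_doubleZeta (show 2 ≤ r + 2 by omega) le_rfl
  have hD' := (Equiv.prodComm ℕ ℕ).hasSum_iff.mpr hD
  have h1 := hasSum_sum (s := range r) fun k hk =>
    hasSum_doubleZeta (s := r + 1 - k) (t := k + 2)
      (by have : k < r := by simpa using hk
          omega) (by omega)
  have h2 := h1.unique <| hasSum_of_forall_eq (hW.sub (hD.add hD')) fun i => by
    have := sum_one_div_pow_mul_pow (a := (i.1 : ℝ) + 1) (b := (i.2 : ℝ) + 1)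
      (by positivity) (by positivity) r
    simp only [doubleZetaTerm, integralTerm, Function.comp, Equiv.prodComm_apply, Prod.fst_swap,
      Prod.snd_swap]
    rw [show (i.1 : ℝ) + 1 + (i.2 + 1) = i.1 + i.2 + 2 by ring] at this
    rw [this, show (i.2 : ℝ) + i.1 + 2 = i.1 + i.2 + 2 by ring]
    push_cast
    rw [show (i.1 : ℝ) + i.2 + 1 + 1 = i.1 + i.2 + 2 by ring]
    have : (i.1 : ℝ) + i.2 + 2 ≠ 0 := by positivity
    field_simp
    ring
  have h3 := tsum_integralTerm_one_eq_doubleZeta r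
  linarith

/-- Euler's evaluation of `∑ H_k / k ^ (r + 2)`. -/
theorem tsum_integralTerm_one_eq_realZeta (r : ℕ) :
    ∑' i, integralTerm 1 (r + 1) 1 i = 2 * realZeta (r + 3) -
      1 / 2 * ∑ k ∈ range r,
        (realZeta (r + 1 - k) * realZeta (k + 2) - realZeta (r + 3)) := by
  have h1 := sum_doubleZeta r
  have h2 : ∑ k ∈ range r, doubleZeta (k + 2) (r + 1 - k) =
      ∑ k ∈ range r, doubleZeta (r + 1 - k) (k + 2) := by
    rw [← sum_range_reflect]
    refine sum_congr rfl fun k hk => ?_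
    have : k < r := by simpa using hk
    congr 1 <;> omega
  have h3 : ∑ k ∈ range r, (realZeta (r + 1 - k) * realZeta (k + 2) - realZeta (r + 3)) =
      ∑ k ∈ range r, doubleZeta (r + 1 - k) (k + 2) +
        ∑ k ∈ range r, doubleZeta (k + 2) (r + 1 - k) := by
    rw [← sum_add_distrib]
    refine sum_congr rfl fun k hk => ?_
    have : k < r := by simpa using hk
    rw [realZeta_mul_realZeta (by omega) (by omega), show r + 1 - k + (k + 2) = r + 3 by omega]
    ring
  linarith

theorem reducibleSum_integralTerm_one_one (r : ℕ) : ReducibleSum (integralTerm 1 (r + 1) 1) := by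
  refine ⟨_, (summable_integralTerm 1 (by omega) le_rfl).hasSum, ?_⟩
  have hz := isReducible_realZeta (show 2 ≤ r + 3 by omega)
  have hs := IsReducibleToZetaValues.finset_sum (range r)
    (fun k => realZeta (r + 1 - k) * realZeta (k + 2) - realZeta (r + 3)) fun k hk => by
      have : k < r := by simpa using hk
      have h := IsReducibleToZetaValues.add
        (isReducible_realZeta_mul (show 2 ≤ r + 1 - k by omega) (show 2 ≤ k + 2 by omega))
        (hz.ratCast_mul (-1))
      convert h using 1
      push_cast
      ring
  convert (hz.ratCast_mul 2).add (hs.ratCast_mul (-1 / 2)) using 1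
  rw [tsum_integralTerm_one_eq_realZeta]
  push_cast
  ring

/-! ### The double series for the integrals -/

/-- The case `m = -1`: the relation `T(p, q + 1) + T(p + 1, q) = ζ(p + 1) ζ(q + 1)` for the Tornheim
sums `T(p, q) = ∑ 1 / (a ^ p b ^ q (a + b))` leads down to Euler's sums `T(p, 1)`. -/
theorem reducibleSum_integralTerm_one (p q : ℕ) :
    ReducibleSum (integralTerm 1 (p + 1) (q + 1)) := by
  induction q generalizing p with
  | zero => exact reducibleSum_integralTerm_one_one p
  | succ q ih =>
    have h : ReducibleSum fun i : ℕ × ℕ =>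
        1 / (((i.1 : ℝ) + 1) ^ (p + 2) * ((i.2 : ℝ) + 1) ^ (q + 2)) :=
      ⟨_, hasSum_realZeta_mul (by omega) (by omega),
        isReducible_realZeta_mul (by omega) (by omega)⟩
    convert h.sub (ih (p + 1)) using 2 with i
    simp only [integralTerm]
    have : (i.1 : ℝ) + i.2 + 1 + 1 ≠ 0 := by positivity
    push_cast
    field_simp
    ring

theorem reducibleSum_one_div_mul_consecutive (q j : ℕ) :
    ReducibleSum fun i : ℕ × ℕ =>
      1 / (((i.2 : ℝ) + 1) ^ (q + 1) * (((i.1 : ℝ) + i.2 + j + 1) * ((i.1 : ℝ) + i.2 + j + 2))) := by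
  have hs : Summable fun i : ℕ × ℕ =>
      1 / (((i.1 : ℝ) + 1) ^ (q + 1) *
        (((i.2 : ℝ) + i.1 + j + 1) * ((i.2 : ℝ) + i.1 + j + 2))) := by
    refine summable_one_div_of_le _ fun a b => ?_
    rw [mul_assoc, mul_comm ((b : ℝ) + 1)]
    dsimp only
    have ha : (0 : ℝ) ≤ a := by positivity
    have hb : (0 : ℝ) ≤ b := by positivity
    have hj : (0 : ℝ) ≤ j := by positivity
    have h1 := le_self_pow_natCast_add_one a (show 1 ≤ q + 1 by omega)
    have h2 : (a : ℝ) + b + 1 ≤ b + a + j + 1 := by linarith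
    have h3 : (b : ℝ) + 1 ≤ b + a + j + 2 := by linarith
    exact mul_le_mul h1 (mul_le_mul h2 h3 (by positivity) (by positivity))
      (by positivity) (by positivity)
  obtain ⟨v, hv, hv'⟩ := reducibleSum_one_div_pow_mul_add q j
  have hfib := hs.hasSum.prod_fiberwise (g := fun b : ℕ =>
    1 / (((b : ℝ) + 1) ^ (q + 1) * ((b : ℝ) + j + 1))) fun b => by
      have h := (hasSum_telescope (b + j)).mul_left (1 / ((b : ℝ) + 1) ^ (q + 1))
      push_cast at h
      rw [one_div_mul_one_div] at h
      refine hasSum_of_forall_eq h fun a => ?_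
      have : (a : ℝ) + b + j + 1 ≠ 0 := by positivity
      have : (a : ℝ) + b + j + 2 ≠ 0 := by positivity
      simp only [← add_assoc]
      field_simp
      ring
  have h : ReducibleSum fun i : ℕ × ℕ =>
      1 / (((i.1 : ℝ) + 1) ^ (q + 1) *
        (((i.2 : ℝ) + i.1 + j + 1) * ((i.2 : ℝ) + i.1 + j + 2))) :=
    ⟨v, by rw [hv.unique hfib]; exact hs.hasSum, hv'⟩
  exact h.comp_swap

/-- Neither series converges alone; the terms of the difference decay fast enough in `a`. -/
theorem reducibleSum_integralTerm_sub_zero (n q : ℕ) :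
    ReducibleSum fun i => integralTerm 1 0 (q + 1) i - integralTerm n 0 (q + 1) i := by
  induction n with
  | zero =>
    convert (reducibleSum_one_div_mul_consecutive q 0).ratCast_mul (-1) using 2 with i
    simp only [integralTerm]
    have : (i.1 : ℝ) + i.2 + 1 ≠ 0 := by positivity
    have : (i.1 : ℝ) + i.2 + 2 ≠ 0 := by positivity
    have : (i.1 : ℝ) + i.2 + 1 + 1 ≠ 0 := by positivity
    push_cast
    simp only [add_zero]
    field_simp
    ring
  | succ n ih =>
    convert ih.add (reducibleSum_one_div_mul_consecutive q n) using 2 with i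
    simp only [integralTerm]
    have : (i.1 : ℝ) + i.2 + n + 1 ≠ 0 := by positivity
    have : (i.1 : ℝ) + i.2 + n + 2 ≠ 0 := by positivity
    have : (i.1 : ℝ) + i.2 + (n + 1) + 1 ≠ 0 := by positivity
    push_cast
    rw [sub_add, sub_right_inj]
    field_simp
    ring

theorem integralTerm_swap (n p q : ℕ) (i : ℕ × ℕ) :
    integralTerm n p q i.swap = integralTerm n q p i := by
  simp only [integralTerm, Prod.fst_swap, Prod.snd_swap]
  congr 1
  ring

theorem reducibleSum_integralTerm (n p q : ℕ) :
    ReducibleSum (integralTerm n (p + 1) (q + 1)) := by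
  rcases eq_or_ne n 1 with rfl | hn
  · exact reducibleSum_integralTerm_one p q
  have hn' : (n : ℝ) - 1 ≠ 0 := sub_ne_zero.mpr (by exact_mod_cast hn)
  induction h : p + q using Nat.strong_induction_on generalizing p q with
  | _ N ih =>
  have left : ∀ p' q', p' + q' ≤ p + q →
      ReducibleSum fun i => integralTerm 1 p' (q' + 1) i - integralTerm n p' (q' + 1) i := by
    rintro (_ | p') q' hpq
    · exact reducibleSum_integralTerm_sub_zero n q'
    · exact (reducibleSum_integralTerm_one p' q').sub (ih (p' + q') (by omega) p' q' rfl)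
  have right := (left q p (by omega)).comp_swap
  simp only [integralTerm_swap] at right
  -- `(a + b + n + 1) - (a + 1) - (b + 1) = n - 1`, for `n` and for `1`
  convert ((left p q le_rfl).add right).ratCast_mul (1 / (n - 1)) using 2 with i
  simp only [integralTerm]
  have : (i.1 : ℝ) + i.2 + n + 1 ≠ 0 := by positivity
  have : (i.1 : ℝ) + i.2 + 1 + 1 ≠ 0 := by positivity
  push_cast
  field_simp
  ring

/-! ### The integral as a double series -/

theorem summable_polylog {x : ℝ} (hx : x ∈ Set.Ioo (0 : ℝ) 1) (p : ℕ) :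
    Summable fun k : ℕ => x ^ (k + 1) / ((k : ℝ) + 1) ^ p := by
  have hx0 := hx.1.le
  refine ((summable_nat_add_iff 1).mpr
    (summable_geometric_of_lt_one hx0 hx.2)).of_nonneg_of_le (fun k => by positivity) fun k => ?_
  exact div_le_self (by positivity) (one_le_pow₀ (by simp))

/-- The term of the expansion of `x ^ (n - 2) Li_p(x) Li_q(x)` for the indices `i`. -/
noncomputable def integrandTerm (n p q : ℕ) (i : ℕ × ℕ) (x : ℝ) : ℝ :=
  1 / (((i.1 : ℝ) + 1) ^ p * ((i.2 : ℝ) + 1) ^ q) * x ^ (i.1 + i.2 + n)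

theorem tsum_integrandTerm (n p q : ℕ) {x : ℝ} (hx : x ∈ Set.Ioo (0 : ℝ) 1) :
    ∑' i, integrandTerm n p q i x = polylogIntegrand (n - 2) p q x := by
  have hx0 : x ≠ 0 := hx.1.ne'
  have hn : ∀ p, Summable fun k : ℕ => ‖x ^ (k + 1) / ((k : ℝ) + 1) ^ p‖ :=
    fun p => (summable_polylog hx p).norm
  rw [polylogIntegrand, mul_assoc, polylog, polylog,
    tsum_mul_tsum_of_summable_norm (hn p) (hn q), ← tsum_mul_left]
  refine tsum_congr fun i => ?_
  rw [integrandTerm, zpow_sub₀ hx0, zpow_natCast]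
  norm_cast
  push_cast
  field_simp
  ring

theorem integral_integrandTerm (n p q : ℕ) (i : ℕ × ℕ) :
    ∫ x in Set.Ioo (0 : ℝ) 1, integrandTerm n p q i x = integralTerm n p q i := by
  rw [← integral_Ioc_eq_integral_Ioo, ← intervalIntegral.integral_of_le zero_le_one]
  simp only [integrandTerm, integralTerm]
  rw [intervalIntegral.integral_const_mul, integral_pow]
  simp
  ring

theorem integrableOn_integrandTerm (n p q : ℕ) (i : ℕ × ℕ) :
    IntegrableOn (integrandTerm n p q i) (Set.Ioo 0 1) := by
  have h : Continuous (integrandTerm n p q i) := by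
    unfold integrandTerm
    fun_prop
  exact (h.integrableOn_Icc (a := 0) (b := 1)).mono_set Set.Ioo_subset_Icc_self

theorem hasSum_setIntegral_polylogIntegrand (n : ℕ) {p q : ℕ} (hp : 1 ≤ p) (hq : 1 ≤ q) :
    HasSum (integralTerm n p q) (∫ x in Set.Ioo (0 : ℝ) 1, polylogIntegrand (n - 2) p q x) := by
  have hnorm : ∀ i, ∫ x in Set.Ioo (0 : ℝ) 1, ‖integrandTerm n p q i x‖ = integralTerm n p q i := by
    intro i
    rw [← integral_integrandTerm]
    refine setIntegral_congr_fun measurableSet_Ioo fun x hx => ?_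
    have := hx.1.le
    exact Real.norm_of_nonneg (by unfold integrandTerm; positivity)
  have h := hasSum_integral_of_summable_integral_norm
    (μ := volume.restrict (Set.Ioo (0 : ℝ) 1)) (F := integrandTerm n p q)
    (integrableOn_integrandTerm n p q)
    (by simpa only [hnorm] using summable_integralTerm n hp hq)
  simp only [integral_integrandTerm] at h
  rwa [setIntegral_congr_fun measurableSet_Ioo fun x hx => tsum_integrandTerm n p q hx] at h

end PolylogIntegral

theorem theorem1 (m : ℤ) (p q : ℕ) (hm : -2 ≤ m) (hp : 1 ≤ p) (hq : 1 ≤ q) :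
    IntervalIntegrable (polylogIntegrand m p q) MeasureTheory.volume 0 1 ∧
      IsReducibleToZetaValues (polylogIntegral m p q) := by
  obtain ⟨n, rfl⟩ : ∃ n : ℕ, m = n - 2 := ⟨(m + 2).toNat, by omega⟩
  have h := PolylogIntegral.hasSum_setIntegral_polylogIntegrand n hp hq
  constructor
  · rw [intervalIntegrable_iff_integrableOn_Ioo_of_le zero_le_one]
    -- a sum of positive terms is nonzero, while a non-integrable function has integral `0`
    refine Integrable.of_integral_ne_zero (ne_of_gt ?_)
    have hpos : ∀ i, 0 < PolylogIntegral.integralTerm n p q i := fun i => by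
      unfold PolylogIntegral.integralTerm
      positivity
    rw [← h.tsum_eq]
    exact h.summable.tsum_pos (fun i => (hpos i).le) (0, 0) (hpos _)
  · obtain ⟨p, rfl⟩ := Nat.exists_eq_add_of_le' hp
    obtain ⟨q, rfl⟩ := Nat.exists_eq_add_of_le' hq
    obtain ⟨v, hv, hv'⟩ := PolylogIntegral.reducibleSum_integralTerm n p q
    rw [polylogIntegral, intervalIntegral.integral_of_le zero_le_one,
      integral_Ioc_eq_integral_Ioo, h.unique hv]
    exact hv'
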